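/- Fix $d\ge 0$. A \emph{labelled Delone set} is the graph $T\subset\mathbb R^d\times X$ of a map from a Delone subset of $\mathbb R^d$ (uniformly discrete and relatively dense) to a compact metric space $X$ of labels; $T-x$ is its translate by $-x$, the labels being carried along. Labelled Delone sets with labels in $X$ carry the usual local topology: $T$ and $T'$ are close if, on a large ball around the origin, each labelled point of either one has a labelled point of the other nearby, both in position and in label. A \emph{tiling space} is a hull $\Omega=\overline{\{T-x : x\in\mathbb R^d\}}$ of a labelled Delone set $T$, with its translation action of $\mathbb R^d$, which is minimal (all orbits are dense in $\Omega$) and aperiodic ($T-x=T$ with $T\in\Omega$ implies $x=0$); finite local complexity is not assumed, and different tiling spaces may have different label spaces. (A tiling is regarded as the labelled Delone set of its punctures, labelled by the prototiles and the labels of the tiles.) The space $\Omega$ is \emph{uniquely ergodic} if it has exactly one translation-invariant Borel probability measure. Let $\Omega,\Omega'$ be tiling spaces of dimension $d$. - They are \emph{orbit equivalent} if there is a homeomorphism $h:\Omega\to\Omega'$ that maps each $\mathbb R^d$-orbit of $\Omega$ onto an $\mathbb R^d$-orbit of $\Omega'$. - They are \emph{topologically conjugate} if there is a homeomorphism $h:\Omega\to\Omega'$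 with $h(T-x)=h(T)-x$ for all $T\in\Omega$, $x\in\mathbb R^d$. - $\Omega'$ is obtained from $\Omega$ by a \emph{continuous shape change} if there are a homeomorphism $h:\Omega\to\Omega'$ and a continuous $1$-cocycle $\alpha:\Omega\times\mathbb R^d\to\mathbb R^d$, i.e. $\alpha(T,x)+\alpha(T-x,y)=\alpha(T,x+y)$, such that for every $T\in\Omega$ the map $\varphi=\alpha(T,\cdot)$ is a homeomorphism of $\mathbb R^d$, $h(T-x)=h(T)-\varphi(x)$ for all $x\in\mathbb R^d$, the points of $h(T)$ are exactly the images $\varphi(x)$ of the points $x$ of $T$, and the label of $\varphi(x)$ in $h(T)$ determines the label of $x$ in $T$, by a rule that depends neither on $T$ nor on $x$. **Corollary.** Within the class of uniquely ergodic tiling spaces of dimension $d$, with or without finite local complexity, the relation ``to be orbit equivalent'' is the equivalence relation generated by topological conjugacies and continuous shape changes. That is, two uniquely ergodic tiling spaces $\Omega$ and $\Omega'$ are orbit equivalent if and only if there is a finite chain $\Omega=\Omega_0,\Omega_1,\dots,\Omega_n=\Omega'$ of uniquely ergodic tiling spaces such that, for each $i<n$, one of $\Omega_i,\Omega_{i+1}$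 is topologically conjugate to, or a continuous shape change of, the other. -/

import Mathlib

open Set Filter Topology MeasureTheory
open scoped Uniformity

universe u

namespace TilingShape

/-- The Euclidean space `ℝᵈ`. -/
abbrev E (d : ℕ) : Type := EuclideanSpace ℝ (Fin d)

/-- A labelled Delone set of `ℝᵈ`: the graph of a map from a Delone set to the label space `X`. -/
@[ext]
structure LabeledDelone (d : ℕ) (X : Type u) where
  graph : Set (E d × X)
  functional : ∀ p ∈ graph, ∀ q ∈ graph, p.1 = q.1 → p.2 = q.2
  isDelone : ∃ D : Delone.DeloneSet (E d), D.carrier = Prod.fst '' graph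

namespace LabeledDelone

variable {d : ℕ} {X : Type u}

/-- The underlying (unlabelled) Delone set. -/
def points (T : LabeledDelone d X) : Set (E d) := Prod.fst '' T.graph

/-- The translate `T + v`: every point moves by `v` and keeps its label. -/
def translate (v : E d) (T : LabeledDelone d X) : LabeledDelone d X where
  graph := (fun p : E d × X => (v + p.1, p.2)) '' T.graph
  functional := by
    rintro _ ⟨p, hp, rfl⟩ _ ⟨q, hq, rfl⟩ h
    exact T.functional p hp q hq (add_left_cancel h)
  isDelone := by
    obtain ⟨D, hD⟩ := T.isDelone
    refine ⟨Delone.DeloneSet.mapIsometry (IsometryEquiv.addLeft v) D, ?_⟩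
    have h1 : (Delone.DeloneSet.mapIsometry (IsometryEquiv.addLeft v) D).carrier
        = (fun x => v + x) '' D.carrier := rfl
    rw [h1, hD, image_image, image_image]

/-- The action of `ℝᵈ` on labelled Delone sets by translation; `T - x` is `(-x) +ᵥ T`. -/
instance : AddAction (E d) (LabeledDelone d X) where
  vadd := translate
  zero_vadd T := by
    apply LabeledDelone.ext
    change (fun p : E d × X => ((0 : E d) + p.1, p.2)) '' T.graph = T.graph
    simp
  add_vadd v w T := by
    apply LabeledDelone.ext
    change (fun p : E d × X => ((v + w) + p.1, p.2)) '' T.graph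
      = (fun p : E d × X => (v + p.1, p.2)) '' ((fun p : E d × X => (w + p.1, p.2)) '' T.graph)
    rw [image_image]
    simp only [add_assoc]

theorem mem_vadd {v : E d} {T : LabeledDelone d X} {p : E d × X} :
    p ∈ (v +ᵥ T).graph ↔ (p.1 - v, p.2) ∈ T.graph := by
  change p ∈ (fun p : E d × X => (v + p.1, p.2)) '' T.graph ↔ _
  constructor
  · rintro ⟨q, hq, rfl⟩
    simpa using hq
  · intro h
    exact ⟨_, h, by simp⟩

variable [MetricSpace X]

/-- `T` and `T'` are `ε`-near if every labelled point of either one inside the ball `B(0, 1/ε)` has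
a labelled point of the other one within `ε`, both in position and in label. (`dist` is the maximum
of the two distances. On Delone sets with a common packing radius `r > 2 ε` the corresponding point
is unique, so that this is a one-to-one correspondence.) -/
def near (d : ℕ) (X : Type u) [MetricSpace X] (ε : ℝ) :
    Set (LabeledDelone d X × LabeledDelone d X) :=
  {P | (∀ p ∈ P.1.graph, ‖p.1‖ < ε⁻¹ → ∃ q ∈ P.2.graph, dist p q < ε) ∧
    (∀ q ∈ P.2.graph, ‖q.1‖ < ε⁻¹ → ∃ p ∈ P.1.graph, dist p q < ε)}

theorem near_mono {ε δ : ℝ} (hε : 0 < ε) (h : ε ≤ δ) : near d X ε ⊆ near d X δ := by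
  rintro ⟨S, T⟩ ⟨h1, h2⟩
  have hinv : δ⁻¹ ≤ ε⁻¹ := inv_anti₀ hε h
  refine ⟨fun p hp hn => ?_, fun q hq hn => ?_⟩
  · obtain ⟨q, hq, hd⟩ := h1 p hp (hn.trans_le hinv)
    exact ⟨q, hq, hd.trans_le h⟩
  · obtain ⟨p, hp, hd⟩ := h2 q hq (hn.trans_le hinv)
    exact ⟨p, hp, hd.trans_le h⟩

theorem near_symm {ε : ℝ} {S T : LabeledDelone d X} (h : (S, T) ∈ near d X ε) :
    (T, S) ∈ near d X ε :=
  ⟨fun p hp hn => by simpa [dist_comm] using h.2 p hp hn,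
    fun p hp hn => by simpa [dist_comm] using h.1 p hp hn⟩

theorem exists_near_scale {ε c : ℝ} (hε : 0 < ε) (hc : 0 ≤ c) :
    ∃ δ, 0 < δ ∧ δ ≤ ε / 2 ∧ ε⁻¹ + c + δ ≤ δ⁻¹ := by
  have hpos : 0 < ε⁻¹ + c + 1 := by positivity
  refine ⟨min (ε / 2) (min 1 (ε⁻¹ + c + 1)⁻¹), by positivity, min_le_left _ _, ?_⟩
  have h1 : min (ε / 2) (min 1 (ε⁻¹ + c + 1)⁻¹) ≤ 1 :=
    (min_le_right _ _).trans (min_le_left _ _)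
  have h2 : min (ε / 2) (min 1 (ε⁻¹ + c + 1)⁻¹) ≤ (ε⁻¹ + c + 1)⁻¹ :=
    (min_le_right _ _).trans (min_le_right _ _)
  have h3 := inv_anti₀ (show 0 < min (ε / 2) (min 1 (ε⁻¹ + c + 1)⁻¹) by positivity) h2
  rw [inv_inv] at h3
  linarith

theorem near_comp {ε δ : ℝ} (h1 : δ ≤ ε / 2) (h2 : ε⁻¹ + δ ≤ δ⁻¹) (hδ : 0 < δ)
    {S T U : LabeledDelone d X} (hST : (S, T) ∈ near d X δ) (hTU : (T, U) ∈ near d X δ) :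
    (S, U) ∈ near d X ε := by
  have key : ∀ {S T U : LabeledDelone d X}, (S, T) ∈ near d X δ → (T, U) ∈ near d X δ →
      ∀ p ∈ S.graph, ‖p.1‖ < ε⁻¹ → ∃ q ∈ U.graph, dist p q < ε := by
    intro S T U hST hTU p hp hn
    obtain ⟨q, hq, hd⟩ := hST.1 p hp (by linarith)
    have hq' : ‖q.1‖ < δ⁻¹ := by
      have h3 : ‖q.1‖ ≤ ‖p.1‖ + dist p.1 q.1 := by
        rw [dist_eq_norm, norm_sub_rev]
        exact norm_le_norm_add_norm_sub' _ _
      have h4 : dist p.1 q.1 ≤ dist p q := le_max_left _ _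
      linarith
    obtain ⟨r, hr, hd'⟩ := hTU.1 q hq hq'
    exact ⟨r, hr, by linarith [dist_triangle p q r]⟩
  refine ⟨key hST hTU, fun q hq hn => ?_⟩
  obtain ⟨p, hp, hd⟩ := key (near_symm hTU) (near_symm hST) q hq hn
  exact ⟨p, hp, by rwa [dist_comm]⟩

/-- The basis of entourages `near d X ε`, `ε > 0`. -/
def nearBasis (d : ℕ) (X : Type u) [MetricSpace X] :
    FilterBasis (LabeledDelone d X × LabeledDelone d X) where
  sets := {V | ∃ ε : ℝ, 0 < ε ∧ V = near d X ε}
  nonempty := ⟨_, 1, one_pos, rfl⟩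
  inter_sets := by
    rintro _ _ ⟨ε, hε, rfl⟩ ⟨δ, hδ, rfl⟩
    exact ⟨_, ⟨min ε δ, lt_min hε hδ, rfl⟩, subset_inter
      (near_mono (lt_min hε hδ) (min_le_left _ _)) (near_mono (lt_min hε hδ) (min_le_right _ _))⟩

/-- The (uniform, hence topological) structure on labelled Delone sets: `T` and `T'` are close if
on a large ball around the origin their labelled points nearly coincide. -/
instance : UniformSpace (LabeledDelone d X) :=
  UniformSpace.ofCore <| UniformSpace.Core.mkOfBasis (nearBasis d X)
    (by
      rintro _ ⟨ε, hε, rfl⟩ T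
      exact ⟨fun p hp _ => ⟨p, hp, by simpa using hε⟩, fun p hp _ => ⟨p, hp, by simpa using hε⟩⟩)
    (by
      rintro _ ⟨ε, hε, rfl⟩
      exact ⟨_, ⟨ε, hε, rfl⟩, fun P hP => near_symm hP⟩)
    (by
      rintro _ ⟨ε, hε, rfl⟩
      obtain ⟨δ, hδ, h1, h2⟩ := exists_near_scale hε le_rfl
      refine ⟨_, ⟨δ, hδ, rfl⟩, ?_⟩
      rintro ⟨S, U⟩ ⟨T, hST, hTU⟩
      exact near_comp h1 (by linarith) hδ hST hTU)

theorem hasBasis_uniformity :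
    (𝓤 (LabeledDelone d X)).HasBasis (fun ε : ℝ => 0 < ε) (near d X) := by
  refine ⟨fun t => ?_⟩
  change t ∈ (nearBasis d X).filter ↔ _
  rw [FilterBasis.mem_filter_iff]
  constructor
  · rintro ⟨_, ⟨ε, hε, rfl⟩, h⟩
    exact ⟨ε, hε, h⟩
  · rintro ⟨ε, hε, h⟩
    exact ⟨_, ⟨ε, hε, rfl⟩, h⟩

theorem near_vadd {ε δ : ℝ} {v : E d} (h1 : δ ≤ ε) (h2 : ε⁻¹ + ‖v‖ ≤ δ⁻¹)
    {S T : LabeledDelone d X} (h : (S, T) ∈ near d X δ) :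
    (v +ᵥ S, v +ᵥ T) ∈ near d X ε := by
  have key : ∀ {S T : LabeledDelone d X}, (S, T) ∈ near d X δ →
      ∀ p ∈ (v +ᵥ S).graph, ‖p.1‖ < ε⁻¹ → ∃ q ∈ (v +ᵥ T).graph, dist p q < ε := by
    intro S T h p hp hn
    obtain ⟨q, hq, hd⟩ := h.1 _ (mem_vadd.1 hp) (by
      have h3 : ‖p.1 - v‖ ≤ ‖p.1‖ + ‖v‖ := norm_sub_le _ _
      linarith)
    refine ⟨(q.1 + v, q.2), mem_vadd.2 (by simpa using hq), ?_⟩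
    have h4 : dist p (q.1 + v, q.2) = dist ((p.1 - v, p.2) : E d × X) q := by
      rw [Prod.dist_eq, Prod.dist_eq]
      simp [dist_eq_norm, sub_sub, add_comm]
    rw [h4]
    linarith
  refine ⟨key h, fun q hq hn => ?_⟩
  obtain ⟨p, hp, hd⟩ := key (near_symm h) q hq hn
  exact ⟨p, hp, by rwa [dist_comm]⟩

instance : ContinuousConstVAdd (E d) (LabeledDelone d X) where
  continuous_const_vadd v := by
    apply UniformContinuous.continuous
    refine (hasBasis_uniformity.uniformContinuous_iff hasBasis_uniformity).2 fun ε hε => ?_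
    obtain ⟨δ, hδ, h1, h2⟩ := exists_near_scale hε (norm_nonneg v)
    exact ⟨δ, hδ, fun S T h => near_vadd (by linarith) (by linarith) h⟩

instance : MeasurableSpace (LabeledDelone d X) := borel _

instance : BorelSpace (LabeledDelone d X) := ⟨rfl⟩

/-- The hull of a labelled Delone set: the closure of its orbit under translation. -/
def hull (T : LabeledDelone d X) : Set (LabeledDelone d X) :=
  closure (AddAction.orbit (E d) T)

theorem vadd_mem_hull {T S : LabeledDelone d X} (v : E d) (h : S ∈ hull T) :
    v +ᵥ S ∈ hull T := by
  refine map_mem_closure (continuous_const_vadd v) h ?_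
  rintro _ ⟨w, rfl⟩
  exact ⟨v + w, add_vadd _ _ _⟩

end LabeledDelone

open LabeledDelone

/-- A (minimal, aperiodic) tiling space of dimension `d`: the hull of a labelled Delone set with
labels in some compact metric space, such that every orbit is dense and no element has a nonzero
period. No finite local complexity is assumed. -/
structure TilingSpace (d : ℕ) : Type (u + 1) where
  Label : Type u
  [metricLabel : MetricSpace Label]
  [compactLabel : CompactSpace Label]
  carrier : Set (LabeledDelone d Label)
  exists_hull : ∃ T, carrier = hull T
  minimal : ∀ T ∈ carrier, hull T = carrier
  aperiodic : ∀ T ∈ carrier, ∀ x : E d, x +ᵥ T = T → x = 0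

attribute [instance] TilingSpace.metricLabel TilingSpace.compactLabel

namespace TilingSpace

variable {d : ℕ}

instance : CoeSort (TilingSpace.{u} d) (Type u) := ⟨fun Ω => Ω.carrier⟩

/-- The translation action of `ℝᵈ` on a tiling space. -/
instance (Ω : TilingSpace.{u} d) : AddAction (E d) Ω where
  vadd x T := ⟨x +ᵥ T.1, by
    obtain ⟨S, hS⟩ := Ω.exists_hull
    exact hS.ge (vadd_mem_hull x (hS.le T.2))⟩
  zero_vadd T := Subtype.ext (zero_vadd (E d) T.1)
  add_vadd x y T := Subtype.ext (add_vadd x y T.1)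

/-- There is exactly one translation-invariant Borel probability measure. -/
def UniquelyErgodic (Ω : TilingSpace.{u} d) : Prop :=
  ∃! μ : Measure Ω, IsProbabilityMeasure μ ∧ VAddInvariantMeasure (E d) Ω μ

/-- `Ω` and `Ω'` are orbit equivalent: some homeomorphism sends orbits onto orbits. -/
def OrbitEquivalent (Ω Ω' : TilingSpace.{u} d) : Prop :=
  ∃ h : Ω ≃ₜ Ω', ∀ T : Ω, h '' AddAction.orbit (E d) T = AddAction.orbit (E d) (h T)

/-- `Ω` and `Ω'` are topologically conjugate: some homeomorphism commutes with translations. -/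
def Conjugate (Ω Ω' : TilingSpace.{u} d) : Prop :=
  ∃ h : Ω ≃ₜ Ω', ∀ (T : Ω) (x : E d), h (x +ᵥ T) = x +ᵥ h T

/-- A continuous (weak) dynamical `1`-cocycle on `Ω` with values in `ℝᵈ`:
`α (T, x) + α (T - x, y) = α (T, x + y)`. -/
structure IsCocycle (Ω : TilingSpace.{u} d) (α : Ω → E d → E d) : Prop where
  continuous : Continuous fun p : Ω × E d => α p.1 p.2
  add : ∀ (T : Ω) (x y : E d), α T x + α ((-x) +ᵥ T) y = α T (x + y)

/-- The homeomorphism `h : Ω → Ω'` is the continuous shape change induced by the cocycle `α`.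
Every `T` is deformed by the homeomorphism `φ = α (T, ·)` of `ℝᵈ`: the points of `h T` are exactly
the points `φ x`, where `x` is a point of `T`, and `h (T - x) = h T - φ x` for all `x ∈ ℝᵈ`.
The combinatorics is kept: the label of `φ x` in `h T` may be finer than the label of `x` in `T`,
but it determines the latter (through the map `ρ`). -/
structure IsShapeChange (Ω Ω' : TilingSpace.{u} d) (h : Ω ≃ₜ Ω') (α : Ω → E d → E d) : Prop where
  cocycle : IsCocycle Ω α
  isHomeomorph : ∀ T : Ω, IsHomeomorph (α T)
  map_sub : ∀ (T : Ω) (x : E d), h ((-x) +ᵥ T) = (-(α T x)) +ᵥ h T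
  points_eq : ∀ T : Ω, (h T).1.points = α T '' T.1.points
  label : ∃ ρ : Ω'.Label → Ω.Label, ∀ (T : Ω) (x : E d) (l : Ω.Label) (l' : Ω'.Label),
    (x, l) ∈ T.1.graph → (α T x, l') ∈ (h T).1.graph → ρ l' = l

/-- `Ω'` is obtained from `Ω` by a continuous shape change. -/
def ShapeChange (Ω Ω' : TilingSpace.{u} d) : Prop :=
  ∃ (h : Ω ≃ₜ Ω') (α : Ω → E d → E d), IsShapeChange Ω Ω' h α

end TilingSpace

/-- Uniquely ergodic tiling spaces of dimension `d`, with or without finite local complexity. -/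
abbrev UETilingSpace (d : ℕ) : Type (u + 1) :=
  {Ω : TilingSpace.{u} d // Ω.UniquelyErgodic}

end TilingShape

/-! An orbit equivalence `h` has, by aperiodicity, a unique displacement `α` with `h (T - x) = h T -
α T x`, and uniqueness forces the cocycle identity. The crux is that `α` is continuous
(`cocycle_continuous`). Near `h T` a point `P` of the tiling can be chosen continuously, and
translating it to the origin projects onto a transversal. An orbit meets the transversal in a
countable set, so the projection is constant along a small connected piece of an orbit, and `α` is
locally a difference of values of `P` (`cocycle_eq_sub_of_mem`).

Now move each point `x` of `T` to `α T x` and label it by `T - x`, an element of the compact metric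
space `Ω`. The result is again Delone because `α` and its inverse cocycle `β` are uniformly
controlled. These deformed sets form a tiling space that is a shape change of `Ω` (`isShapeChange`).
Its deformation map has the same cocycle as `h`, so it is conjugate to `Ω'` (`conjugate`), from
which it inherits unique ergodicity. Conversely, both generating relations preserve orbits. -/

namespace TilingShape

/-! ### Delone constants, metrizability and compactness of hulls -/

namespace LabeledDelone

variable {d : ℕ} {X : Type u}

/-- The points of `T` are `r`-separated, and every ball of radius `R` contains one of them. -/
def IsDeloneWith (r R : ℝ) (T : LabeledDelone d X) : Prop :=
  (∀ p ∈ T.graph, ∀ q ∈ T.graph, dist p.1 q.1 < r → p = q) ∧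
    ∀ x : E d, ∃ p ∈ T.graph, dist x p.1 ≤ R

theorem exists_isDeloneWith (T : LabeledDelone d X) :
    ∃ r R : ℝ, 0 < r ∧ IsDeloneWith r R T := by
  obtain ⟨D, hD⟩ := T.isDelone
  refine ⟨D.packingRadius, D.coveringRadius, D.packingRadius_pos, fun p hp q hq hpq => ?_,
    fun x => ?_⟩
  · have hp' : p.1 ∈ D := by
      change p.1 ∈ D.carrier
      exact hD ▸ mem_image_of_mem _ hp
    have hq' : q.1 ∈ D := by
      change q.1 ∈ D.carrier
      exact hD ▸ mem_image_of_mem _ hq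
    have h : p.1 = q.1 := by
      by_contra hne
      exact (D.packingRadius_lt_dist_of_mem_ne hp' hq' hne).not_gt hpq
    exact Prod.ext h (T.functional p hp q hq h)
  · obtain ⟨y, hy, hxy⟩ := D.exists_dist_le_coveringRadius x
    have hy' : y ∈ Prod.fst '' T.graph := hD ▸ (show y ∈ D.carrier from hy)
    obtain ⟨p, hp, rfl⟩ := hy'
    exact ⟨p, hp, hxy⟩

theorem exists_deloneSet {G : Set (E d × X)} {r R : ℝ} (hr : 0 < r)
    (hsep : ∀ p ∈ G, ∀ q ∈ G, dist p.1 q.1 < r → p = q)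
    (hcov : ∀ x : E d, ∃ p ∈ G, dist x p.1 ≤ R) :
    ∃ D : Delone.DeloneSet (E d), D.carrier = Prod.fst '' G := by
  have hr2 : 0 < r / 2 := by positivity
  -- The packing radius is halved because a Delone set requires strict separation; `max R 1` keeps
  -- the covering radius positive.
  refine ⟨⟨Prod.fst '' G, (r / 2).toNNReal, by simpa using hr, ?_, (max R 1).toNNReal,
    by simp, ?_⟩, rfl⟩
  · rintro _ ⟨p, hp, rfl⟩ _ ⟨q, hq, rfl⟩ hne
    have h : r ≤ dist p.1 q.1 := by
      by_contra! hlt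
      exact hne (congrArg Prod.fst (hsep p hp q hq hlt))
    change ENNReal.ofReal (r / 2) < edist p.1 q.1
    rw [edist_dist, ENNReal.ofReal_lt_ofReal_iff (by linarith)]
    linarith
  · intro x _
    obtain ⟨p, hp, hxp⟩ := hcov x
    refine ⟨p.1, mem_image_of_mem _ hp, ?_⟩
    change edist x p.1 ≤ ENNReal.ofReal (max R 1)
    rw [edist_dist]
    exact ENNReal.ofReal_le_ofReal (hxp.trans (le_max_left _ _))

theorem IsDeloneWith.vadd {r R : ℝ} {T : LabeledDelone d X} (h : IsDeloneWith r R T) (v : E d) :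
    IsDeloneWith r R (v +ᵥ T) := by
  refine ⟨fun p hp q hq hpq => ?_, fun x => ?_⟩
  · have h1 := h.1 _ (mem_vadd.1 hp) _ (mem_vadd.1 hq) (by simpa using hpq)
    rw [Prod.mk.injEq] at h1
    exact Prod.ext (sub_left_injective h1.1) h1.2
  · obtain ⟨p, hp, hxp⟩ := h.2 (x - v)
    refine ⟨(p.1 + v, p.2), mem_vadd.2 (by simpa using hp), ?_⟩
    change dist x (p.1 + v) ≤ R
    rwa [dist_eq_norm, add_comm, ← sub_sub, ← dist_eq_norm]

theorem countable_points (T : LabeledDelone d X) : T.points.Countable := by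
  obtain ⟨r, R, hr, h, -⟩ := T.exists_isDeloneWith
  have : DiscreteTopology T.points := by
    refine DiscreteTopology.of_forall_le_dist hr ?_
    rintro ⟨_, p, hp, rfl⟩ ⟨_, q, hq, rfl⟩ hne
    by_contra! hlt
    exact hne (Subtype.ext (congrArg Prod.fst (h p hp q hq hlt)))
  exact countable_coe_iff.1 (TopologicalSpace.separableSpace_iff_countable.1 inferInstance)

theorem points_nonempty (T : LabeledDelone d X) : T.points.Nonempty := by
  obtain ⟨r, R, -, -, h⟩ := T.exists_isDeloneWith
  obtain ⟨p, hp, -⟩ := h 0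
  exact ⟨p.1, mem_image_of_mem _ hp⟩

theorem mem_points_vadd {v x : E d} {T : LabeledDelone d X} :
    x ∈ (v +ᵥ T).points ↔ x - v ∈ T.points := by
  constructor
  · rintro ⟨p, hp, rfl⟩
    exact ⟨_, mem_vadd.1 hp, rfl⟩
  · rintro ⟨p, hp, hpx⟩
    refine ⟨(x, p.2), mem_vadd.2 ?_, rfl⟩
    simpa [← hpx] using hp

variable [MetricSpace X]

/-- By separation, all points of `T` within `r / 2` of `p` coincide, so a single one is at distance
zero from `p`. -/
instance : T0Space (LabeledDelone d X) := by
  refine t0Space_iff_uniformity.2 fun S T h => ?_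
  have key : ∀ {S T : LabeledDelone d X}, (∀ ε : ℝ, 0 < ε → (S, T) ∈ near d X ε) →
      S.graph ⊆ T.graph := by
    intro S T h p hp
    obtain ⟨r, R, hr, hT, -⟩ := T.exists_isDeloneWith
    have h1 : ∀ ε : ℝ, 0 < ε → ∃ q ∈ T.graph, dist p q < ε := by
      intro ε hε
      have hε' : 0 < min ε (‖p.1‖ + 1)⁻¹ := by positivity
      obtain ⟨q, hq, hd⟩ := (h _ hε').1 p hp (by
        have := inv_anti₀ hε' (min_le_right ε (‖p.1‖ + 1)⁻¹)
        rw [inv_inv] at this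
        linarith)
      exact ⟨q, hq, hd.trans_le (min_le_left _ _)⟩
    obtain ⟨q, hq, hpq⟩ := h1 (r / 2) (by positivity)
    suffices p = q from this ▸ hq
    refine eq_of_forall_dist_le fun ε hε => ?_
    obtain ⟨q', hq', hpq'⟩ := h1 (min ε (r / 2)) (by positivity)
    have h2 : dist q.1 q'.1 < r := by
      have h3 : dist q.1 q'.1 ≤ dist q q' := le_max_left _ _
      have h4 := dist_triangle_left q q' p
      have h5 := hpq'.trans_le (min_le_right _ _)
      linarith
    rw [hT q hq q' hq' h2]
    exact (hpq'.trans_le (min_le_left _ _)).le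
  have hn : ∀ ε : ℝ, 0 < ε → (S, T) ∈ near d X ε :=
    fun ε hε => h _ (hasBasis_uniformity.mem_of_mem hε)
  exact LabeledDelone.ext ((key hn).antisymm (key fun ε hε => near_symm (hn ε hε)))

instance : IsCountablyGenerated (𝓤 (LabeledDelone d X)) := by
  refine (HasBasis.isCountablyGenerated (ι := ℕ) (p := fun _ => True)
    (s := fun n => near d X (1 / ((n : ℝ) + 1))) ?_)
  refine hasBasis_uniformity.to_hasBasis (fun ε hε => ?_) fun n _ =>
    ⟨_, by positivity, Subset.rfl⟩
  obtain ⟨n, hn⟩ := exists_nat_one_div_lt hε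
  exact ⟨n, trivial, near_mono (by positivity) hn.le⟩

theorem near_vadd_left {ε δ : ℝ} {v : E d} (h1 : δ ≤ ε / 2) (h2 : ε⁻¹ + δ ≤ δ⁻¹)
    (hv : ‖v‖ < δ) {S T : LabeledDelone d X} (h : (S, T) ∈ near d X δ) :
    (v +ᵥ S, T) ∈ near d X ε := by
  have hδ : 0 < δ := (norm_nonneg v).trans_lt hv
  refine near_comp h1 h2 hδ (T := S) ?_ h
  refine ⟨fun p hp _ => ⟨_, mem_vadd.1 hp, ?_⟩, fun p hp _ =>
    ⟨(p.1 + v, p.2), mem_vadd.2 (by simpa using hp), ?_⟩⟩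
  · simpa [Prod.dist_eq, hδ] using hv
  · simpa [Prod.dist_eq, hδ] using hv

instance : ContinuousVAdd (E d) (LabeledDelone d X) where
  continuous_vadd := by
    rw [continuous_iff_continuousAt]
    rintro ⟨v, T⟩
    -- Joint continuity is only needed at zero translation: `(w, S)` is first sent to `(w - v, v +
    -- S)`.
    have h0 : ContinuousAt (fun q : E d × LabeledDelone d X => q.1 +ᵥ q.2) (0, v +ᵥ T) := by
      refine (nhds_basis_uniformity hasBasis_uniformity).tendsto_right_iff.2 fun ε hε => ?_
      obtain ⟨δ, hδ, h1, h2⟩ := exists_near_scale hε le_rfl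
      rw [nhds_prod_eq]
      filter_upwards [prod_mem_prod (Metric.ball_mem_nhds (0 : E d) hδ)
        ((nhds_basis_uniformity hasBasis_uniformity).mem_of_mem hδ)] with q hq
      have := near_vadd_left h1 (by linarith) (by simpa using hq.1) hq.2
      simpa using this
    have h1 : ContinuousAt (fun q : E d × LabeledDelone d X => (q.1 - v, v +ᵥ q.2)) (v, T) := by
      fun_prop
    have h2 := ContinuousAt.comp_of_eq h0 h1 (by simp)
    refine h2.congr (Eventually.of_forall fun q => ?_)
    simp [vadd_vadd]

/-- The labelled Delone sets with given packing and covering radii form a compact space. -/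
theorem isCompact_setOf_isDeloneWith [CompactSpace X] {r R : ℝ} (hr : 0 < r) :
    IsCompact {T : LabeledDelone d X | IsDeloneWith r R T} := by
  rw [isCompact_iff_ultrafilter_le_nhds']
  intro F hF
  -- The limit of the ultrafilter consists of the labelled points approached by `F`-most sets `S`.
  set G : Set (E d × X) := {p | ∀ ε : ℝ, 0 < ε → ∀ᶠ S in (F : Filter (LabeledDelone d X)),
    ∃ q ∈ S.graph, dist p q < ε} with hG
  -- Points chosen in `K` from `F`-most `S` converge along the ultrafilter, by compactness, and
  -- their limit lies in `G`.
  have hmeet : ∀ K : Set (E d × X), IsCompact K →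
      (∀ᶠ S in (F : Filter (LabeledDelone d X)), ∃ q ∈ S.graph, q ∈ K) → ∃ p ∈ G, p ∈ K := by
    intro K hK hSK
    obtain ⟨S₀, q₀, -, -⟩ := hSK.exists
    have : Nonempty (E d × X) := ⟨q₀⟩
    choose! f hf using fun S (h : ∃ q ∈ LabeledDelone.graph S, q ∈ K) => h
    have hle : (↑(F.map f) : Filter (E d × X)) ≤ 𝓟 K := by
      rw [le_principal_iff]
      exact hSK.mono fun S hS => (hf S hS).2
    obtain ⟨p, hpK, hp⟩ := hK.ultrafilter_le_nhds (F.map f) hle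
    refine ⟨p, fun ε hε => ?_, hpK⟩
    have h1 : ∀ᶠ S in (F : Filter (LabeledDelone d X)), f S ∈ Metric.ball p ε :=
      hp (Metric.ball_mem_nhds p hε)
    filter_upwards [h1, hSK] with S h1 h2
    exact ⟨f S, (hf S h2).1, by rwa [dist_comm]⟩
  have hsep : ∀ p ∈ G, ∀ q ∈ G, dist p.1 q.1 < r → p = q := by
    intro p hp q hq hpq
    refine eq_of_forall_dist_le fun ε hε => ?_
    set η := min (ε / 2) ((r - dist p.1 q.1) / 2) with hη
    have hη0 : 0 < η := by
      have : 0 < r - dist p.1 q.1 := by linarith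
      positivity
    obtain ⟨S, ⟨⟨p', hp', hpp'⟩, q', hq', hqq'⟩, hS⟩ :=
      (((hp η hη0).and (hq η hη0)).and hF).exists
    have h1 : η ≤ ε / 2 := min_le_left _ _
    have h2 : η ≤ (r - dist p.1 q.1) / 2 := min_le_right _ _
    have h3 : dist p.1 p'.1 ≤ dist p p' := le_max_left _ _
    have h4 : dist q.1 q'.1 ≤ dist q q' := le_max_left _ _
    have h5 : dist p'.1 q'.1 < r := by
      have := dist_triangle4 p'.1 p.1 q.1 q'.1
      rw [dist_comm p'.1 p.1] at this
      linarith
    have h6 := hS.1 p' hp' q' hq' h5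
    subst h6
    linarith [dist_triangle_right p q p']
  have hcov : ∀ x : E d, ∃ p ∈ G, dist x p.1 ≤ R := by
    intro x
    obtain ⟨p, hp, hpK⟩ := hmeet (Metric.closedBall x R ×ˢ univ)
      ((isCompact_closedBall x R).prod isCompact_univ) (by
        filter_upwards [hF] with S hS
        obtain ⟨p, hp, hxp⟩ := hS.2 x
        exact ⟨p, hp, by rwa [Metric.mem_closedBall, dist_comm], mem_univ _⟩)
    exact ⟨p, hp, by rw [dist_comm]; exact hpK.1⟩
  refine ⟨⟨G, fun p hp q hq h => congrArg Prod.snd (hsep p hp q hq (by simpa [h] using hr)),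
    exists_deloneSet hr hsep hcov⟩, ⟨hsep, hcov⟩, ?_⟩
  refine (nhds_basis_uniformity hasBasis_uniformity).ge_iff.2 fun ε hε => ?_
  -- A finite `ε / 4`-net reduces nearness to finitely many conditions, each of which holds for
  -- `F`-most `S`.
  have hK : IsCompact (Metric.closedBall (0 : E d) ε⁻¹ ×ˢ (univ : Set X)) :=
    (isCompact_closedBall _ _).prod isCompact_univ
  obtain ⟨t, -, htf, ht⟩ := hK.finite_cover_balls (show 0 < ε / 4 by positivity)
  have hev : ∀ᶠ S in (F : Filter (LabeledDelone d X)), ∀ c ∈ t,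
      ((∃ p ∈ G, dist p c < ε / 4) → ∃ q ∈ S.graph, dist q c < ε / 2) ∧
      ((∃ q ∈ S.graph, dist q c < ε / 4) → ∃ p ∈ G, dist p c < ε / 2) := by
    refine (eventually_all_finite htf).2 fun c _ => Eventually.and ?_ ?_
    · by_cases hc : ∃ p ∈ G, dist p c < ε / 4
      · obtain ⟨p, hp, hpc⟩ := hc
        filter_upwards [hp (ε / 4) (by positivity)] with S hS _
        obtain ⟨q, hq, hpq⟩ := hS
        exact ⟨q, hq, by linarith [dist_triangle_left q c p]⟩
      · exact Eventually.of_forall fun S h => absurd h hc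
    · by_cases hc : ∀ᶠ S in (F : Filter (LabeledDelone d X)), ∃ q ∈ S.graph, dist q c < ε / 4
      · have hcK : IsCompact (Metric.closedBall c (ε / 4)) := by
          rw [← closedBall_prod_same (x := c.1) (y := c.2)]
          exact (isCompact_closedBall _ _).prod Metric.isClosed_closedBall.isCompact
        obtain ⟨p, hp, hpc⟩ := hmeet _ hcK
          (hc.mono fun S ⟨q, hq, hqc⟩ => ⟨q, hq, hqc.le⟩)
        exact Eventually.of_forall fun S _ =>
          ⟨p, hp, lt_of_le_of_lt hpc (by linarith)⟩
      · exact (Ultrafilter.eventually_not.2 hc).mono fun S h h' => absurd h' h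
  have hcover : ∀ p : E d × X, ‖p.1‖ < ε⁻¹ → ∃ c ∈ t, dist p c < ε / 4 := by
    intro p hp
    have : p ∈ Metric.closedBall (0 : E d) ε⁻¹ ×ˢ (univ : Set X) := ⟨by simpa using hp.le, trivial⟩
    simpa using ht this
  filter_upwards [hev] with S hS
  refine ⟨fun p hp hpn => ?_, fun q hq hqn => ?_⟩
  · obtain ⟨c, hc, hpc⟩ := hcover p hpn
    obtain ⟨q, hq, hqc⟩ := (hS c hc).2 ⟨p, hp, hpc⟩
    exact ⟨q, hq, by linarith [dist_triangle_right p q c]⟩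
  · obtain ⟨c, hc, hqc⟩ := hcover q hqn
    obtain ⟨p, hp, hpc⟩ := (hS c hc).1 ⟨q, hq, hqc⟩
    exact ⟨p, hp, by linarith [dist_triangle_right p q c]⟩

theorem exists_hull_subset [CompactSpace X] (T : LabeledDelone d X) :
    ∃ r R : ℝ, 0 < r ∧ hull T ⊆ {S | IsDeloneWith r R S} := by
  obtain ⟨r, R, hr, hT⟩ := T.exists_isDeloneWith
  refine ⟨r, R, hr, closure_minimal ?_ (isCompact_setOf_isDeloneWith hr).isClosed⟩
  rintro _ ⟨v, rfl⟩
  exact hT.vadd v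

theorem isCompact_hull [CompactSpace X] (T : LabeledDelone d X) : IsCompact (hull T) := by
  obtain ⟨r, R, hr, hT⟩ := T.exists_hull_subset
  exact (isCompact_setOf_isDeloneWith hr).of_isClosed_subset isClosed_closure hT

end LabeledDelone

end TilingShape

namespace TilingShape

/-! ### Local choice of points and free translation action -/

namespace LabeledDelone

variable {d : ℕ} {X : Type u} [MetricSpace X]

theorem isOpen_setOf_points_inter_nonempty {V : Set (E d)} (hV : IsOpen V) :
    IsOpen {S : LabeledDelone d X | (S.points ∩ V).Nonempty} := by
  rw [isOpen_iff_mem_nhds]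
  rintro S ⟨_, ⟨q, hq, rfl⟩, hqV⟩
  obtain ⟨η, hη, hηV⟩ := Metric.isOpen_iff.1 hV _ hqV
  -- The bound `(‖q.1‖ + 1)⁻¹` places `q` inside the ball on which nearness compares the two sets.
  have hε : 0 < min η (‖q.1‖ + 1)⁻¹ := by positivity
  filter_upwards [(nhds_basis_uniformity' hasBasis_uniformity).mem_of_mem hε] with S' hS'
  obtain ⟨q', hq', hd⟩ := hS'.1 q hq (by
    have := inv_anti₀ hε (min_le_right η (‖q.1‖ + 1)⁻¹)
    rw [inv_inv] at this
    linarith)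
  refine ⟨q'.1, mem_image_of_mem _ hq', hηV ?_⟩
  rw [Metric.mem_ball, dist_comm]
  exact (le_max_left _ _).trans_lt (hd.trans_le (min_le_left _ _))

end LabeledDelone

open LabeledDelone

namespace TilingSpace

variable {d : ℕ}

theorem coe_vadd {Ω : TilingSpace.{u} d} (x : E d) (T : Ω) :
    ((x +ᵥ T : Ω) : LabeledDelone d Ω.Label) = x +ᵥ T.1 := rfl

instance (Ω : TilingSpace.{u} d) : Nonempty Ω := by
  obtain ⟨T, hT⟩ := Ω.exists_hull
  exact ⟨⟨T, hT.ge (subset_closure (AddAction.mem_orbit_self T))⟩⟩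

instance (Ω : TilingSpace.{u} d) : CompactSpace Ω := by
  obtain ⟨T, hT⟩ := Ω.exists_hull
  exact isCompact_iff_compactSpace.1 (hT ▸ isCompact_hull T)

instance (Ω : TilingSpace.{u} d) : ContinuousVAdd (E d) Ω where
  continuous_vadd := Continuous.subtype_mk
    (continuous_fst.vadd (continuous_subtype_val.comp continuous_snd)) _

/-- `Ω` will itself be the label space of the deformed sets, hence needs a metric compatible with
its topology. -/
noncomputable instance (Ω : TilingSpace.{u} d) : MetricSpace Ω :=
  UniformSpace.metricSpace Ω

theorem exists_isDeloneWith (Ω : TilingSpace.{u} d) :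
    ∃ r R : ℝ, 0 < r ∧ ∀ T : Ω, IsDeloneWith r R T.1 := by
  obtain ⟨T, hT⟩ := Ω.exists_hull
  obtain ⟨r, R, hr, h⟩ := T.exists_hull_subset
  exact ⟨r, R, hr, fun S => h (hT.le S.2)⟩

theorem vadd_left_injective {Ω : TilingSpace.{u} d} (T : Ω) :
    Function.Injective fun x : E d => x +ᵥ T := by
  intro x y hxy
  have h : (x - y) +ᵥ T = T := by
    change x +ᵥ T = y +ᵥ T at hxy
    rw [sub_eq_neg_add, add_vadd, hxy, neg_vadd_vadd]
  exact sub_eq_zero.1 (Ω.aperiodic T.1 T.2 _ (congrArg Subtype.val h))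

/-- Near each element of a tiling space one can continuously choose a point. -/
theorem exists_continuousOn_mem_points {Ω : TilingSpace.{u} d} (T : Ω) :
    ∃ (U : Set Ω) (P : Ω → E d), IsOpen U ∧ T ∈ U ∧ ContinuousOn P U ∧
      ∀ S ∈ U, P S ∈ S.1.points := by
  obtain ⟨r, R, hr, hD⟩ := Ω.exists_isDeloneWith
  obtain ⟨p, hp⟩ := T.1.points_nonempty
  have hr2 : 0 < r / 2 := by positivity
  choose! P hP using fun (S : Ω) (h : (S.1.points ∩ Metric.ball p (r / 2)).Nonempty) => h
  -- A ball of radius `r / 2` holds at most one point of each `S`, so the choice is forced and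
  -- therefore continuous.
  refine ⟨{S | (S.1.points ∩ Metric.ball p (r / 2)).Nonempty}, P,
    (isOpen_setOf_points_inter_nonempty Metric.isOpen_ball).preimage continuous_subtype_val,
    ⟨p, hp, Metric.mem_ball_self hr2⟩, fun S hS => ?_, fun S hS => (hP S hS).1⟩
  refine ContinuousAt.continuousWithinAt (Metric.tendsto_nhds.2 fun ε hε => ?_)
  have hmem := ((isOpen_setOf_points_inter_nonempty (X := Ω.Label)
    (Metric.isOpen_ball.inter (Metric.isOpen_ball (x := P S) (ε := ε)))).preimage
      continuous_subtype_val).mem_nhds (show S ∈ _ from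
        ⟨P S, (hP S hS).1, (hP S hS).2, Metric.mem_ball_self hε⟩)
  filter_upwards [hmem] with S' hS'
  obtain ⟨q, hq, hq1, hq2⟩ := hS'
  obtain ⟨h1, h2⟩ := hP S' ⟨q, hq, hq1⟩
  have h3 : P S' = q := by
    obtain ⟨a, ha, ha'⟩ := h1
    obtain ⟨b, hb, hb'⟩ := hq
    rw [← ha', ← hb']
    refine congrArg Prod.fst ((hD S').1 a ha b hb ?_)
    rw [ha', hb']
    have := dist_triangle_right (P S') q p
    rw [Metric.mem_ball] at h2 hq1
    linarith
  rw [h3]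
  exact hq2

/-! ### Continuity of the displacement cocycle -/

section Cocycle

variable {Ω Ω' : TilingSpace.{u} d} {h : Ω ≃ₜ Ω'} {α : Ω → E d → E d}

/-- Translations act freely on `Ω'`. The algebraic laws of `α` all follow from this. -/
theorem cocycle_unique (hα : ∀ (T : Ω) (x : E d), h ((-x) +ᵥ T) = (-(α T x)) +ᵥ h T)
    {T : Ω} {x y : E d} (hy : h ((-x) +ᵥ T) = (-y) +ᵥ h T) : α T x = y := by
  rw [hα] at hy
  exact neg_injective (vadd_left_injective _ hy)

theorem cocycle_add (hα : ∀ (T : Ω) (x : E d), h ((-x) +ᵥ T) = (-(α T x)) +ᵥ h T)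
    (T : Ω) (x y : E d) : α T x + α ((-x) +ᵥ T) y = α T (x + y) := by
  refine (cocycle_unique hα ?_).symm
  rw [neg_add_rev, add_vadd, hα, hα, vadd_vadd, neg_add_rev]

theorem cocycle_zero (hα : ∀ (T : Ω) (x : E d), h ((-x) +ᵥ T) = (-(α T x)) +ᵥ h T)
    (T : Ω) : α T 0 = 0 :=
  cocycle_unique hα (by simp)

theorem cocycle_sub (hα : ∀ (T : Ω) (x : E d), h ((-x) +ᵥ T) = (-(α T x)) +ᵥ h T)
    (T : Ω) (x y : E d) : α ((-x) +ᵥ T) (y - x) = α T y - α T x := by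
  rw [eq_sub_iff_add_eq', cocycle_add hα, add_sub_cancel]

/-- A path inside an orbit that stays in a small open set does not change its transversal. -/
theorem cocycle_eq_sub_of_mem
    (hα : ∀ (T : Ω) (x : E d), h ((-x) +ᵥ T) = (-(α T x)) +ᵥ h T)
    {U : Set Ω'} {P : Ω' → E d} (hPc : ContinuousOn P U) (hP : ∀ S ∈ U, P S ∈ S.1.points)
    {T : Ω} {δ : ℝ} (hU : ∀ x ∈ Metric.ball (0 : E d) δ, h ((-x) +ᵥ T) ∈ U)
    {x : E d} (hx : x ∈ Metric.ball (0 : E d) δ) :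
    α T x = P (h T) - P (h ((-x) +ᵥ T)) := by
  set γ : E d → Ω' := fun x => h ((-x) +ᵥ T) with hγ
  have hγc : Continuous γ := by fun_prop
  have hπc : ContinuousOn (fun x => (-(P (γ x))) +ᵥ γ x) (Metric.ball (0 : E d) δ) :=
    (hPc.comp hγc.continuousOn hU).neg.vadd hγc.continuousOn
  have hπ : ∀ x, (-(P (γ x))) +ᵥ γ x = (-(α T x + P (γ x))) +ᵥ h T := by
    intro x
    rw [neg_add_rev, add_vadd, ← hα]
  -- The projected path stays among the translates of `h T` that bring one of its points to the
  -- origin.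
  have hcount : ((fun x => (-(P (γ x))) +ᵥ γ x) '' Metric.ball (0 : E d) δ).Countable := by
    refine ((countable_points (h T).1).image fun c => (-c) +ᵥ h T).mono ?_
    rintro _ ⟨x, hx, rfl⟩
    refine ⟨α T x + P (γ x), ?_, (hπ x).symm⟩
    have h1 := hP _ (hU x hx)
    rw [hα, coe_vadd, mem_points_vadd, sub_neg_eq_add, ← hα] at h1
    rwa [add_comm]
  have hconn : IsPreconnected ((fun x => (-(P (γ x))) +ᵥ γ x) '' Metric.ball (0 : E d) δ) :=
    (convex_ball (0 : E d) δ).isPreconnected.image _ hπc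
  have hδ : 0 < δ := Metric.pos_of_mem_ball hx
  have h0 : (0 : E d) ∈ Metric.ball (0 : E d) δ := Metric.mem_ball_self hδ
  -- A countable subset of a metric space is totally disconnected, so the connected image is a
  -- single element.
  have heq := hcount.isTotallyDisconnected _ Subset.rfl hconn
    (mem_image_of_mem _ hx) (mem_image_of_mem _ h0)
  simp only [hπ] at heq
  have h2 := neg_injective (vadd_left_injective _ heq)
  rw [cocycle_zero hα, zero_add] at h2
  have h3 : γ 0 = h T := by simp [hγ]
  rw [h3] at h2
  rw [← h2, add_sub_cancel_right]

/-- On a product neighbourhood of `(T, 0)`, one `P` and one `δ` serve all nearby tilings, and the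
local formula for `α` is visibly continuous. -/
theorem cocycle_eventually_continuousAt
    (hα : ∀ (T : Ω) (x : E d), h ((-x) +ᵥ T) = (-(α T x)) +ᵥ h T) (T : Ω) :
    ∀ᶠ p in 𝓝 (T, (0 : E d)), ContinuousAt (fun p : Ω × E d => α p.1 p.2) p := by
  obtain ⟨U, P, hUo, hTU, hPc, hP⟩ := exists_continuousOn_mem_points (h T)
  have hcont : Continuous fun p : Ω × E d => h ((-p.2) +ᵥ p.1) := by fun_prop
  have hev : ∀ᶠ p : Ω × E d in 𝓝 (T, (0 : E d)), h ((-p.2) +ᵥ p.1) ∈ U :=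
    hcont.continuousAt.eventually_mem (hUo.mem_nhds (by simpa using hTU))
  rw [nhds_prod_eq] at hev
  obtain ⟨V, hV, W, hW, hVW⟩ := mem_prod_iff.1 hev
  obtain ⟨δ, hδ, hδW⟩ := Metric.mem_nhds_iff.1 hW
  have hU : ∀ S ∈ V, ∀ x ∈ Metric.ball (0 : E d) δ, h ((-x) +ᵥ S) ∈ U :=
    fun S hS x hx => hVW (mk_mem_prod hS (hδW hx))
  have hV' : interior V ×ˢ Metric.ball (0 : E d) δ ∈ 𝓝 (T, (0 : E d)) :=
    (isOpen_interior.prod Metric.isOpen_ball).mem_nhds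
      ⟨mem_interior_iff_mem_nhds.2 hV, Metric.mem_ball_self hδ⟩
  filter_upwards [hV'] with p hp
  have hnear : interior V ×ˢ Metric.ball (0 : E d) δ ∈ 𝓝 p :=
    (isOpen_interior.prod Metric.isOpen_ball).mem_nhds hp
  have hPat : ∀ S ∈ U, ContinuousAt P S := fun S hS => hPc.continuousAt (hUo.mem_nhds hS)
  have h1 : ContinuousAt (fun p : Ω × E d => P (h p.1) - P (h ((-p.2) +ᵥ p.1))) p := by
    refine ContinuousAt.sub ?_ ?_
    · refine ContinuousAt.comp (g := P) (hPat _ ?_) (by fun_prop)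
      simpa using hU p.1 (interior_subset hp.1) 0 (Metric.mem_ball_self hδ)
    · exact ContinuousAt.comp (g := P) (hPat _ (hU p.1 (interior_subset hp.1) _ hp.2))
        hcont.continuousAt
  refine h1.congr ?_
  filter_upwards [hnear] with q hq
  exact (cocycle_eq_sub_of_mem hα hPc hP (hU q.1 (interior_subset hq.1)) hq.2).symm

/-- The cocycle identity carries continuity from small vectors to all: for fixed `T`, the good
vectors form a nonempty clopen subset of the connected space `ℝᵈ`. -/
theorem cocycle_continuous
    (hα : ∀ (T : Ω) (x : E d), h ((-x) +ᵥ T) = (-(α T x)) +ᵥ h T) :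
    Continuous fun p : Ω × E d => α p.1 p.2 := by
  rw [continuous_iff_continuousAt]
  rintro ⟨T, x⟩
  have hshift : ∀ (y : E d) (p : Ω × E d), α p.1 p.2 = α p.1 y + α ((-y) +ᵥ p.1) (p.2 - y) :=
    fun y p => by rw [cocycle_add hα, add_sub_cancel]
  have hstep : ∀ y z : E d, ContinuousAt (fun p : Ω × E d => α p.1 p.2) (T, y) →
      ContinuousAt (fun p : Ω × E d => α p.1 p.2) ((-y) +ᵥ T, z - y) →
      ContinuousAt (fun p : Ω × E d => α p.1 p.2) (T, z) := by
    intro y z hy hz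
    rw [funext (hshift y)]
    refine ContinuousAt.add ?_ ?_
    · exact ContinuousAt.comp_of_eq (g := fun p : Ω × E d => α p.1 p.2)
        (f := fun p : Ω × E d => (p.1, y)) hy (by fun_prop) rfl
    · exact ContinuousAt.comp_of_eq (g := fun p : Ω × E d => α p.1 p.2)
        (f := fun p : Ω × E d => ((-y) +ᵥ p.1, p.2 - y)) hz (by fun_prop) rfl
  have hclopen : IsClopen {y : E d | ContinuousAt (fun p : Ω × E d => α p.1 p.2) (T, y)} := by
    constructor
    -- As `y` tends to `z`, `(T - y, z - y)` tends to `(T - z, 0)`, near which `α` is continuous;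
    -- some good `y` is close enough.
    · refine isClosed_of_closure_subset fun z hz => ?_
      have h1 : Tendsto (fun y : E d => ((-y) +ᵥ T, z - y)) (𝓝 z) (𝓝 ((-z) +ᵥ T, 0)) := by
        have : Continuous fun y : E d => ((-y) +ᵥ T, z - y) := by fun_prop
        simpa using this.tendsto z
      obtain ⟨y, hy, hy'⟩ :=
        ((mem_closure_iff_frequently.1 hz).and_eventually
          (h1.eventually (cocycle_eventually_continuousAt hα _))).exists
      exact hstep y z hy hy'
    · refine isOpen_iff_mem_nhds.2 fun y hy => ?_
      have h1 : Tendsto (fun z : E d => ((-y) +ᵥ T, z - y)) (𝓝 y) (𝓝 ((-y) +ᵥ T, 0)) := by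
        have : Continuous fun z : E d => ((-y) +ᵥ T, z - y) := by fun_prop
        simpa using this.tendsto y
      filter_upwards [h1.eventually (cocycle_eventually_continuousAt hα _)] with z hz
      exact hstep y z hy hz
  have huniv := hclopen.eq_univ ⟨0, (cocycle_eventually_continuousAt hα T).self_of_nhds⟩
  exact huniv.ge (mem_univ x)

end Cocycle

/-- The homeomorphism `h` and its inverse are intertwined with translations by the mutually inverse
cocycles `α` and `β`. -/
structure IsOrbitCocycle {Ω Ω' : TilingSpace.{u} d} (h : Ω ≃ₜ Ω') (α : Ω → E d → E d)
    (β : Ω' → E d → E d) : Prop where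
  map_sub : ∀ (T : Ω) (x : E d), h ((-x) +ᵥ T) = (-(α T x)) +ᵥ h T
  symm_map_sub : ∀ (T : Ω') (x : E d), h.symm ((-x) +ᵥ T) = (-(β T x)) +ᵥ h.symm T
  left_inv : ∀ (T : Ω) (x : E d), β (h T) (α T x) = x
  right_inv : ∀ (T : Ω) (y : E d), α T (β (h T) y) = y

/-- An orbit equivalence and its inverse are intertwined with translations by mutually inverse
cocycles. -/
theorem exists_isOrbitCocycle {Ω Ω' : TilingSpace.{u} d} {h : Ω ≃ₜ Ω'}
    (hh : ∀ T : Ω, h '' AddAction.orbit (E d) T = AddAction.orbit (E d) (h T)) :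
    ∃ (α : Ω → E d → E d) (β : Ω' → E d → E d), IsOrbitCocycle h α β := by
  have hex : ∀ (T : Ω) (x : E d), ∃ y : E d, h ((-x) +ᵥ T) = (-y) +ᵥ h T := by
    intro T x
    obtain ⟨y, hy⟩ := (hh T).le (mem_image_of_mem h ⟨-x, rfl⟩)
    exact ⟨-y, by rw [neg_neg]; exact hy.symm⟩
  have hex' : ∀ (T : Ω') (x : E d), ∃ y : E d, h.symm ((-x) +ᵥ T) = (-y) +ᵥ h.symm T := by
    intro T x
    obtain ⟨S, ⟨y, rfl⟩, hy⟩ := (hh (h.symm T)).ge ⟨-x, rfl⟩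
    refine ⟨-y, ?_⟩
    rw [h.symm_apply_eq, neg_neg]
    simpa using hy.symm
  choose α hα using hex
  choose β hβ using hex'
  refine ⟨α, β, hα, hβ, fun T x => cocycle_unique hβ ?_, fun T y => cocycle_unique hα ?_⟩
  · rw [← hα, h.symm_apply_apply, h.symm_apply_apply]
  · have h1 := hβ (h T) y
    rw [h.symm_apply_apply] at h1
    rw [← h1, h.apply_symm_apply]

end TilingSpace

end TilingShape

namespace TilingShape

/-! ### The deformed tiling space -/

open LabeledDelone

namespace TilingSpace

variable {d : ℕ}

theorem exists_forall_norm_le {Ω : TilingSpace.{u} d} {α : Ω → E d → E d}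
    (hα : Continuous fun p : Ω × E d => α p.1 p.2) (R : ℝ) :
    ∃ C : ℝ, ∀ (T : Ω) (x : E d), ‖x‖ ≤ R → ‖α T x‖ ≤ C := by
  obtain ⟨C, hC⟩ := ((isCompact_univ (X := Ω)).prod
    (isCompact_closedBall (0 : E d) R)).exists_bound_of_continuousOn hα.continuousOn
  exact ⟨C, fun T x hx => hC (T, x) ⟨mem_univ _, by simpa using hx⟩⟩

theorem exists_forall_norm_lt {Ω : TilingSpace.{u} d} {α : Ω → E d → E d}
    (hα : Continuous fun p : Ω × E d => α p.1 p.2) (h0 : ∀ T, α T 0 = 0) {r : ℝ} (hr : 0 < r) :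
    ∃ s : ℝ, 0 < s ∧ ∀ (T : Ω) (x : E d), ‖x‖ < s → ‖α T x‖ < r := by
  have h1 : ∀ᶠ x in 𝓝 (0 : E d), ∀ T ∈ (univ : Set Ω), ‖α T x‖ < r := by
    refine isCompact_univ.eventually_forall_of_forall_eventually fun T _ => ?_
    have h2 : Continuous fun z : E d × Ω => ‖α z.2 z.1‖ := (hα.comp continuous_swap).norm
    exact h2.continuousAt.eventually_lt_const (by simpa [h0] using hr)
  obtain ⟨s, hs, hsr⟩ := Metric.eventually_nhds_iff.1 h1
  exact ⟨s, hs, fun T x hx => hsr (by simpa using hx) T (mem_univ _)⟩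

namespace IsOrbitCocycle

variable {Ω Ω' : TilingSpace.{u} d} {h : Ω ≃ₜ Ω'} {α : Ω → E d → E d} {β : Ω' → E d → E d}

theorem injective (H : IsOrbitCocycle h α β) (T : Ω) : Function.Injective (α T) :=
  Function.LeftInverse.injective (H.left_inv T)

theorem isHomeomorph (H : IsOrbitCocycle h α β) (T : Ω) : IsHomeomorph (α T) := by
  have hα : Continuous (α T) := (cocycle_continuous H.map_sub).comp (by fun_prop :
    Continuous fun x : E d => (T, x))
  have hβ : Continuous (β (h T)) := (cocycle_continuous H.symm_map_sub).comp (by fun_prop :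
    Continuous fun x : E d => (h T, x))
  exact (Homeomorph.mk ⟨α T, β (h T), H.left_inv T, H.right_inv T⟩ hα hβ).isHomeomorph

/-- The graph of the deformed Delone set: the point `x` of `T` moves to `α T x`, and is labelled by
the whole of `T - x`. -/
def deformGraph (α : Ω → E d → E d) (T : Ω) : Set (E d × Ω) :=
  (fun x => (α T x, (-x) +ᵥ T)) '' T.1.points

/-- Since `α (T - q) (p - q) = α T p - α T q`, uniform smallness of `β` near zero gives the
separation, and boundedness of `α` on the ball of radius `R` gives the covering. -/
theorem exists_sep_cov (H : IsOrbitCocycle h α β) :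
    ∃ r R : ℝ, 0 < r ∧ ∀ T : Ω,
      (∀ p ∈ deformGraph α T, ∀ q ∈ deformGraph α T, dist p.1 q.1 < r → p = q) ∧
      ∀ y : E d, ∃ p ∈ deformGraph α T, dist y p.1 ≤ R := by
  obtain ⟨r, R, hr, hD⟩ := Ω.exists_isDeloneWith
  obtain ⟨s, hs, hsr⟩ := exists_forall_norm_lt (cocycle_continuous H.symm_map_sub)
    (cocycle_zero H.symm_map_sub) hr
  obtain ⟨C, hC⟩ := exists_forall_norm_le (cocycle_continuous H.map_sub) R
  refine ⟨s, C, hs, fun T => ⟨?_, fun y => ?_⟩⟩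
  · rintro _ ⟨_, ⟨p, hp, rfl⟩, rfl⟩ _ ⟨_, ⟨q, hq, rfl⟩, rfl⟩ hpq
    have h1 := hsr (h ((-q.1) +ᵥ T)) (α ((-q.1) +ᵥ T) (p.1 - q.1)) (by
      rw [cocycle_sub H.map_sub, ← dist_eq_norm]
      exact hpq)
    rw [H.left_inv, ← dist_eq_norm] at h1
    rw [(hD T).1 p hp q hq h1]
  · obtain ⟨p, hp, hxp⟩ := (hD T).2 (β (h T) y)
    refine ⟨_, mem_image_of_mem _ (mem_image_of_mem _ hp), ?_⟩
    have h1 := hC ((-(β (h T) y)) +ᵥ T) (p.1 - β (h T) y) (by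
      rwa [← dist_eq_norm, dist_comm])
    rwa [cocycle_sub H.map_sub, H.right_inv, ← dist_eq_norm, dist_comm] at h1

/-- The deformed Delone set. -/
def deform (H : IsOrbitCocycle h α β) (T : Ω) : LabeledDelone d Ω where
  graph := deformGraph α T
  functional := by
    rintro _ ⟨x, -, rfl⟩ _ ⟨y, -, rfl⟩ hxy
    have h1 : x = y := H.injective T hxy
    rw [h1]
  isDelone := by
    obtain ⟨r, R, hr, hT⟩ := H.exists_sep_cov
    exact exists_deloneSet hr (hT T).1 (hT T).2

theorem deform_points (H : IsOrbitCocycle h α β) (T : Ω) :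
    (H.deform T).points = α T '' T.1.points := by
  change Prod.fst '' ((fun x => (α T x, (-x) +ᵥ T)) '' T.1.points) = _
  rw [image_image]

theorem deform_sub (H : IsOrbitCocycle h α β) (T : Ω) (x : E d) :
    H.deform ((-x) +ᵥ T) = (-(α T x)) +ᵥ H.deform T := by
  apply LabeledDelone.ext
  change (fun y => (α ((-x) +ᵥ T) y, (-y) +ᵥ ((-x) +ᵥ T))) '' ((-x) +ᵥ T.1).points =
    (fun p : E d × Ω => (-(α T x) + p.1, p.2)) '' ((fun y => (α T y, (-y) +ᵥ T)) '' T.1.points)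
  have h1 : ((-x) +ᵥ T.1).points = (fun y => y - x) '' T.1.points := by
    ext z
    rw [mem_points_vadd, sub_neg_eq_add]
    exact ⟨fun hz => ⟨z + x, hz, add_sub_cancel_right z x⟩,
      by rintro ⟨y, hy, rfl⟩; simpa using hy⟩
  rw [h1, image_image, image_image]
  refine image_congr fun y _ => Prod.ext ?_ ?_
  · change α ((-x) +ᵥ T) (y - x) = -(α T x) + α T y
    rw [cocycle_sub H.map_sub, neg_add_eq_sub]
  · change (-(y - x)) +ᵥ ((-x) +ᵥ T) = (-y) +ᵥ T
    rw [vadd_vadd]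
    congr 1
    abel

/-- One labelled point recovers the tiling: a common label puts `S` and `T` in one orbit, and equal
positions make the displacement between them vanish. -/
theorem deform_injective (H : IsOrbitCocycle h α β) : Function.Injective H.deform := by
  intro S T hST
  obtain ⟨x, hx⟩ := S.1.points_nonempty
  have h1 : (α S x, (-x) +ᵥ S) ∈ (H.deform T).graph := hST ▸ mem_image_of_mem _ hx
  obtain ⟨y, -, hy⟩ := h1
  rw [Prod.mk.injEq] at hy
  have h2 : (-(x - y)) +ᵥ S = T := by
    rw [neg_sub, sub_eq_add_neg, add_vadd, ← hy.2, vadd_vadd, add_neg_cancel, zero_vadd]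
  have h3 : α S (x - y) = α S 0 := by
    have := cocycle_add H.map_sub S (x - y) y
    rw [h2, hy.1, sub_add_cancel, add_eq_right] at this
    rw [this, cocycle_zero H.map_sub]
  rw [← h2, H.injective S h3, neg_zero, zero_vadd]

/-- A deformed labelled point depends continuously on the tiling and the original point, uniformly
on compact sets; `β` bounds the original points that land in the ball of radius `ε⁻¹`. -/
theorem deform_continuous (H : IsOrbitCocycle h α β) : Continuous H.deform := by
  have hα := cocycle_continuous H.map_sub
  rw [continuous_iff_continuousAt]
  intro T
  refine (nhds_basis_uniformity hasBasis_uniformity).tendsto_right_iff.2 fun ε hε => ?_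
  obtain ⟨C, hC⟩ := exists_forall_norm_le (cocycle_continuous H.symm_map_sub) ε⁻¹
  have hC0 : 0 ≤ C := (norm_nonneg _).trans (hC (h T) 0 (by simpa using hε.le))
  have hf : Continuous fun p : Ω × E d => (α p.1 p.2, (-p.2) +ᵥ p.1) := by fun_prop
  have hK : IsCompact ((univ : Set Ω) ×ˢ Metric.closedBall (0 : E d) (C + 1)) :=
    isCompact_univ.prod (isCompact_closedBall _ _)
  obtain ⟨δ, hδ, hδf⟩ := Metric.uniformContinuousOn_iff.1
    (hK.uniformContinuousOn_of_continuous hf.continuousOn) ε hε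
  -- Here `δ` feeds uniform continuity, `1` keeps the partner `q` in the ball of radius `C + 1`, and
  -- `(C + 1)⁻¹` makes nearness apply to `p`.
  set η := min (min δ 1) (C + 1)⁻¹ with hη
  have hη0 : 0 < η := by positivity
  have hηδ : η ≤ δ := (min_le_left _ _).trans (min_le_left _ _)
  have hη1 : η ≤ 1 := (min_le_left _ _).trans (min_le_right _ _)
  have hηC : C + 1 ≤ η⁻¹ := by
    have := inv_anti₀ hη0 (min_le_right _ _)
    rwa [inv_inv] at this
  have key : ∀ S S' : Ω, dist S S' < δ → (S.1, S'.1) ∈ near d Ω.Label η →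
      ∀ p ∈ (H.deform S).graph, ‖p.1‖ < ε⁻¹ → ∃ q ∈ (H.deform S').graph, dist p q < ε := by
    rintro S S' hSS' hnear _ ⟨_, ⟨p, hp, rfl⟩, rfl⟩ hpn
    have hpC : ‖p.1‖ ≤ C := by
      have := hC (h S) _ hpn.le
      rwa [H.left_inv] at this
    obtain ⟨q, hq, hpq⟩ := hnear.1 p hp (by linarith)
    have hpq1 : dist p.1 q.1 < η := (le_max_left _ _).trans_lt hpq
    have hqC : ‖q.1‖ ≤ C + 1 := by
      have h1 := norm_le_norm_add_norm_sub' q.1 p.1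
      rw [← dist_eq_norm, dist_comm] at h1
      linarith
    refine ⟨_, mem_image_of_mem _ (mem_image_of_mem _ hq), ?_⟩
    refine hδf (S, p.1) ⟨mem_univ _, ?_⟩ (S', q.1) ⟨mem_univ _, ?_⟩ ?_
    · simpa using hpC.trans (by linarith)
    · simpa using hqC
    · exact max_lt hSS' (hpq1.trans_le hηδ)
  have hev : ∀ᶠ S : Ω in 𝓝 T, (S.1, T.1) ∈ near d Ω.Label η :=
    continuous_subtype_val.continuousAt.eventually
      ((nhds_basis_uniformity hasBasis_uniformity).mem_of_mem hη0)
  filter_upwards [hev, Metric.ball_mem_nhds T hδ] with S hS hST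
  refine ⟨key S T hST hS, fun q hq hqn => ?_⟩
  obtain ⟨p, hp, hpq⟩ := key T S (by rw [dist_comm]; exact hST) (near_symm hS) q hq hqn
  exact ⟨p, hp, by rwa [dist_comm]⟩

theorem image_orbit (H : IsOrbitCocycle h α β) (T : Ω) :
    H.deform '' AddAction.orbit (E d) T = AddAction.orbit (E d) (H.deform T) := by
  ext S
  constructor
  · rintro ⟨_, ⟨x, rfl⟩, rfl⟩
    refine ⟨-(α T (-x)), ?_⟩
    change -(α T (-x)) +ᵥ H.deform T = H.deform (x +ᵥ T)
    rw [← H.deform_sub, neg_neg]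
  · rintro ⟨y, rfl⟩
    refine ⟨_, ⟨-(β (h T) (-y)), rfl⟩, ?_⟩
    change H.deform (-(β (h T) (-y)) +ᵥ T) = y +ᵥ H.deform T
    rw [H.deform_sub, H.right_inv, neg_neg]

theorem closure_orbit (T : Ω) : closure (AddAction.orbit (E d) T) = univ := by
  have h1 : AddAction.orbit (E d) T.1 = Subtype.val '' AddAction.orbit (E d) T := by
    change range _ = _ '' range _
    rw [← range_comp]
    rfl
  ext S
  rw [closure_subtype, ← h1]
  exact iff_of_true ((Ω.minimal T.1 T.2).ge S.2) trivial

/-- A continuous map on a compact space commutes with closure, so minimality of `Ω` passes to the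
deformed sets. -/
theorem hull_deform (H : IsOrbitCocycle h α β) (T : Ω) :
    hull (H.deform T) = range H.deform := by
  rw [hull, ← H.image_orbit, ← image_univ, ← closure_orbit T]
  exact (image_closure_of_isCompact isClosed_closure.isCompact
    H.deform_continuous.continuousOn).symm

/-- The tiling space of all deformed Delone sets. -/
noncomputable def deformSpace (H : IsOrbitCocycle h α β) : TilingSpace.{u} d where
  Label := Ω
  carrier := range H.deform
  exists_hull := by
    obtain ⟨T⟩ := (inferInstance : Nonempty Ω)
    exact ⟨_, (H.hull_deform T).symm⟩
  minimal := by
    rintro _ ⟨T, rfl⟩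
    exact H.hull_deform T
  aperiodic := by
    rintro _ ⟨T, rfl⟩ x hx
    -- A period `x` of the deformed set pulls back through `β` to a period of `T`, which is zero.
    have h1 : H.deform ((-(β (h T) (-x))) +ᵥ T) = H.deform T := by
      rw [H.deform_sub, H.right_inv, neg_neg, hx]
    have h2 := Ω.aperiodic T.1 T.2 _ (congrArg Subtype.val (H.deform_injective h1))
    have h3 := H.right_inv T (-x)
    rw [neg_eq_zero.1 h2, cocycle_zero H.map_sub] at h3
    exact neg_eq_zero.1 h3.symm

/-- The map sending each element of `Ω` to its deformation. -/
noncomputable def deformHomeo (H : IsOrbitCocycle h α β) : Ω ≃ₜ H.deformSpace :=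
  Continuous.homeoOfEquivCompactToT2 (f := Equiv.ofInjective H.deform H.deform_injective)
    (H.deform_continuous.subtype_mk _)

theorem deformHomeo_sub (H : IsOrbitCocycle h α β) (T : Ω) (x : E d) :
    H.deformHomeo ((-x) +ᵥ T) = (-(α T x)) +ᵥ H.deformHomeo T :=
  Subtype.ext (H.deform_sub T x)

theorem isShapeChange (H : IsOrbitCocycle h α β) :
    IsShapeChange Ω H.deformSpace H.deformHomeo α where
  cocycle := ⟨cocycle_continuous H.map_sub, cocycle_add H.map_sub⟩
  isHomeomorph := H.isHomeomorph
  map_sub := H.deformHomeo_sub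
  points_eq := H.deform_points
  label := by
    have hne : Nonempty Ω.Label := by
      obtain ⟨T⟩ := (inferInstance : Nonempty Ω)
      obtain ⟨_, p, -, -⟩ := T.1.points_nonempty
      exact ⟨p.2⟩
    -- The rule `ρ` reads off the label at the origin: the new label of `x` is `T - x`, where the
    -- origin carries the old one.
    choose! ρ hρ using fun (S : Ω) (hS : ∃ l, ((0 : E d), l) ∈ S.1.graph) => hS
    refine ⟨ρ, ?_⟩
    rintro T x l _ hx ⟨y, -, hy⟩
    obtain rfl : y = x := H.injective T (congrArg Prod.fst hy)
    obtain rfl := congrArg Prod.snd hy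
    have h0 : ((0 : E d), l) ∈ ((-y) +ᵥ T : Ω).1.graph := mem_vadd.2 (by simpa using hx)
    exact ((-y) +ᵥ T : Ω).1.functional _ (hρ _ ⟨l, h0⟩) _ h0 rfl

/-- The deformation and `h` have the same cocycle, which cancels when one is composed with the
inverse of the other. -/
theorem conjugate (H : IsOrbitCocycle h α β) : Conjugate Ω' H.deformSpace := by
  refine ⟨h.symm.trans H.deformHomeo, fun T x => ?_⟩
  change H.deformHomeo (h.symm (x +ᵥ T)) = x +ᵥ H.deformHomeo (h.symm T)
  have h1 := H.symm_map_sub T (-x)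
  rw [neg_neg] at h1
  have h2 := H.right_inv (h.symm T) (-x)
  rw [h.apply_symm_apply] at h2
  rw [h1, H.deformHomeo_sub, h2, neg_neg]

end IsOrbitCocycle

/-! ### Transport of unique ergodicity and orbit equivalence -/

theorem map_invariant {Ω Ω' : TilingSpace.{u} d} {h : Ω ≃ₜ Ω'}
    (hh : ∀ (T : Ω) (x : E d), h (x +ᵥ T) = x +ᵥ h T) {μ : Measure Ω}
    (hμ : IsProbabilityMeasure μ ∧ VAddInvariantMeasure (E d) Ω μ) :
    IsProbabilityMeasure (μ.map h) ∧ VAddInvariantMeasure (E d) Ω' (μ.map h) := by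
  have hm : Measurable h := h.continuous.measurable
  have := hμ.1
  refine ⟨Measure.isProbabilityMeasure_map hm.aemeasurable, ⟨fun x s hs => ?_⟩⟩
  have hx : Measurable fun T : Ω' => x +ᵥ T := (continuous_const_vadd x).measurable
  rw [Measure.map_apply hm (hx hs), Measure.map_apply hm hs,
    ← hμ.2.measure_preimage_vadd x (hm hs)]
  congr 1
  ext T
  simp [hh]

theorem UniquelyErgodic.of_conjugate {Ω Ω' : TilingSpace.{u} d} (hΩ : Ω.UniquelyErgodic)
    (hc : Conjugate Ω Ω') : Ω'.UniquelyErgodic := by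
  obtain ⟨h, hh⟩ := hc
  obtain ⟨μ, hμ, huniq⟩ := hΩ
  have hh' : ∀ (T : Ω') (x : E d), h.symm (x +ᵥ T) = x +ᵥ h.symm T := fun T x => by
    rw [h.symm_apply_eq, hh, h.apply_symm_apply]
  refine ⟨μ.map h, map_invariant hh hμ, fun ν hν => ?_⟩
  rw [← huniq _ (map_invariant hh' hν), Measure.map_map h.continuous.measurable
    h.symm.continuous.measurable, h.self_comp_symm, Measure.map_id]

theorem OrbitEquivalent.refl (Ω : TilingSpace.{u} d) : OrbitEquivalent Ω Ω :=
  ⟨Homeomorph.refl _, fun _ => image_id _⟩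

theorem OrbitEquivalent.symm {Ω Ω' : TilingSpace.{u} d} (hΩ : OrbitEquivalent Ω Ω') :
    OrbitEquivalent Ω' Ω := by
  obtain ⟨h, hh⟩ := hΩ
  refine ⟨h.symm, fun T => ?_⟩
  have h1 := hh (h.symm T)
  rw [h.apply_symm_apply] at h1
  rw [← h1, ← image_comp, h.symm_comp_self, image_id]

theorem OrbitEquivalent.trans {Ω Ω' Ω'' : TilingSpace.{u} d} (hΩ : OrbitEquivalent Ω Ω')
    (hΩ' : OrbitEquivalent Ω' Ω'') : OrbitEquivalent Ω Ω'' := by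
  obtain ⟨h, hh⟩ := hΩ
  obtain ⟨g, hg⟩ := hΩ'
  refine ⟨h.trans g, fun T => ?_⟩
  change (g ∘ h) '' _ = AddAction.orbit (E d) (g (h T))
  rw [image_comp, hh, hg]

theorem Conjugate.orbitEquivalent {Ω Ω' : TilingSpace.{u} d} (hΩ : Conjugate Ω Ω') :
    OrbitEquivalent Ω Ω' := by
  obtain ⟨h, hh⟩ := hΩ
  refine ⟨h, fun T => ?_⟩
  change _ '' range _ = range _
  rw [← range_comp]
  exact congrArg range (funext fun x => hh T x)

theorem ShapeChange.orbitEquivalent {Ω Ω' : TilingSpace.{u} d} (hΩ : ShapeChange Ω Ω') :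
    OrbitEquivalent Ω Ω' := by
  obtain ⟨h, α, hα⟩ := hΩ
  refine ⟨h, fun T => ?_⟩
  ext S
  constructor
  · rintro ⟨_, ⟨x, rfl⟩, rfl⟩
    refine ⟨-(α T (-x)), ?_⟩
    change -(α T (-x)) +ᵥ h T = h (x +ᵥ T)
    rw [← hα.map_sub, neg_neg]
  · rintro ⟨y, rfl⟩
    obtain ⟨x, hx⟩ := (hα.isHomeomorph T).surjective (-y)
    refine ⟨_, ⟨-x, rfl⟩, ?_⟩
    change h (-x +ᵥ T) = y +ᵥ h T
    rw [hα.map_sub, hx, neg_neg]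

end TilingSpace

end TilingShape

theorem mainTheorem5 (d : ℕ) (Ω Ω' : TilingShape.UETilingSpace.{u} d) :
    TilingShape.TilingSpace.OrbitEquivalent Ω.1 Ω'.1 ↔
      Relation.EqvGen
        (fun A B : TilingShape.UETilingSpace.{u} d =>
          TilingShape.TilingSpace.Conjugate A.1 B.1 ∨ TilingShape.TilingSpace.ShapeChange A.1 B.1)
        Ω Ω' := by
  constructor
  · rintro ⟨h, hh⟩
    obtain ⟨α, β, H⟩ := TilingShape.TilingSpace.exists_isOrbitCocycle hh
    -- Unique ergodicity comes from `Ω'` by conjugacy; it need not be carried through the shape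
    -- change from `Ω`.
    let Ω'' : TilingShape.UETilingSpace.{u} d := ⟨H.deformSpace, Ω'.2.of_conjugate H.conjugate⟩
    exact .trans _ Ω'' _ (.rel _ _ (.inr ⟨_, _, H.isShapeChange⟩))
      (.symm _ _ (.rel _ _ (.inl H.conjugate)))
  · intro h
    induction h with
    | rel A B hAB => exact hAB.elim (·.orbitEquivalent) (·.orbitEquivalent)
    | refl A => exact .refl _
    | symm A B _ ih => exact ih.symm
    | trans A B C _ _ ih1 ih2 => exact ih1.trans ih2
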